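/- Let $r\ge 2$. An ordered $r$-graph is an $r$-uniform hypergraph whose vertex set is linearly ordered. For $k\ge 1$, an $r$-uniform crossing $k$-path $P_k^r$ in an ordered $r$-graph consists of distinct vertices $v_0,v_1,\dots,v_{r+k-2}$ such that each set $\{v_i,v_{i+1},\dots,v_{i+r-1}\}$, $0\le i<k$, is an edge, and such that, where the chains run over all indices at most $r+k-2$: (i) $v_0<v_1<\dots<v_{r-1}$; (ii) $v_j<v_{j+r}<v_{j+2r}<\dots<v_{j+1}$ for every $0\le j<r-1$; (iii) $v_0<v_{r-1}<v_{2r-1}<v_{3r-1}<\dots<v_{\lfloor (r+k-1)/r\rfloor r-1}$. Let $\mathrm{ex}_{\to}(n,P_k^r)$ denote the maximum number of edges in an $n$-vertex ordered $r$-graph that contains no crossing $k$-path. **Theorem.** Fix $k\ge 1$ and $r\ge 2$. If $k\le r+1$, then for all $n\ge r+k$ $$\mathrm{ex}_{\to}(n,P_k^r)=\binom{n}{r}-\binom{n-k+1}{r}.$$ If $k\ge r+2$, then $\mathrm{ex}_{\to}(n,P_k^r)=\Theta(n^{r-1}\log n)$; that is, there are constants $c,C>0$ depending only on $k$ and $r$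 such that for all $n\ge r+k$ $$c\,n^{r-1}\log n\le \mathrm{ex}_{\to}(n,P_k^r)\le C\,n^{r-1}\log n.$$ -/

import Mathlib

/-- An `r`-uniform hypergraph on the linearly ordered vertex set `V`, given by its edge set
(an ordered `r`-graph). -/
def IsOrderedRGraph {V : Type*} [LinearOrder V] (r : ℕ) (H : Finset (Finset V)) : Prop :=
  ∀ e ∈ H, e.card = r

/-- `v 0, v 1, …, v (r + k - 2)` list the vertices of a tight `k`-path in `H`: each of the `k` sets
`{v i, …, v (i + r - 1)}`, `i < k`, is an edge of `H`, and the listed vertices are distinct.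
The values `v i` for `i ≥ r + k - 1` play no role. -/
def IsTightPath {V : Type*} [LinearOrder V] (r k : ℕ) (H : Finset (Finset V)) (v : ℕ → V) :
    Prop :=
  Set.InjOn v (Set.Iio (r + k - 1)) ∧ ∀ i < k, (Finset.Ico i (i + r)).image v ∈ H

/-- The order condition on the vertices `v 0, …, v (r + k - 2)` of a crossing path. -/
structure IsCrossingOrder {V : Type*} [LinearOrder V] (r k : ℕ) (v : ℕ → V) : Prop where
  /-- `v 0 < v 1 < ⋯ < v (r - 1)` -/
  first : ∀ j, j + 1 < r → v j < v (j + 1)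
  /-- `v j < v (j + r) < v (j + 2 r) < ⋯` for `j < r - 1`, over all indices at most `r + k - 2` -/
  chain : ∀ j, j + 1 < r → ∀ m, j + (m + 1) * r < r + k - 1 →
    v (j + m * r) < v (j + (m + 1) * r)
  /-- all members of the `j`-th chain precede `v (j + 1)`, for `j < r - 1` -/
  chain_lt : ∀ j, j + 1 < r → ∀ m, j + m * r < r + k - 1 → v (j + m * r) < v (j + 1)
  /-- `v 0 < v (r - 1)` -/
  zero_lt_last : v 0 < v (r - 1)
  /-- `v (r - 1) < v (2 r - 1) < v (3 r - 1) < ⋯`, over all indices at most `r + k - 2` -/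
  last : ∀ m, (r - 1) + (m + 1) * r < r + k - 1 →
    v ((r - 1) + m * r) < v ((r - 1) + (m + 1) * r)

/-- `H` contains an `r`-uniform crossing `k`-path. -/
def ContainsCrossingPath {V : Type*} [LinearOrder V] (r k : ℕ) (H : Finset (Finset V)) : Prop :=
  ∃ v : ℕ → V, IsTightPath r k H v ∧ IsCrossingOrder r k v

open Classical in
/-- The maximum number of edges of an ordered `r`-graph on `n` vertices (with vertex set `Fin n` in
its natural order) that contains no `r`-uniform crossing `k`-path. -/
noncomputable def exOrderedCrossingPath (n r k : ℕ) : ℕ :=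
  ((Finset.univ : Finset (Finset (Finset (Fin n)))).filter
    (fun H => IsOrderedRGraph r H ∧ ¬ ContainsCrossingPath r k H)).sup Finset.card

/-! View edges as increasing `r`-tuples. A crossing `k`-path is the trace of tuples `F 0, …, F (k -
1)`, each obtained from its predecessor by raising one coordinate, cyclically in the order `0, 1, …,
r - 1`, with every entry `q` staying below the initial value of each later entry
(`IsStepSequence.containsCrossingPath`). Such sequences come from peeling: from each line in
direction `p`, delete the least tuple. What survives `k - 1` rounds ends a step sequence, and each
round deletes a set determined by `r - 1` coordinates.

For `k ≤ r + 1` each coordinate moves at most once, so separation is automatic. A path-free family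
is then exhausted after `k - 1` rounds, and the gaps forced by earlier rounds sharpen the cost of
round `j` to `(n - j - 1).choose (r - 1)`; Pascal's rule sums these. Equality holds for the sets
with some trivial gap among the first `k - 1`, since the first edge of a path has none.

For longer paths, separation is enforced by fixing the dyadic blocks of the entries. Each of the
`O(log n)` scales contributes `O(n ^ (r - 1))` edges. The matching construction takes the sets whose
two least elements differ by a power of two. -/

/-! ### Peeling and step sequences -/

/-- The members of `A` that arise from another member of `A` by increasing the coordinate `p`. -/
def peel {ι V : Type*} [DecidableEq ι] [Fintype ι] [LinearOrder V] (p : ι) (A : Finset (ι → V)) :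
    Finset (ι → V) :=
  A.filter fun f => ∃ g ∈ A, (∀ q, q ≠ p → g q = f q) ∧ g p < f p

theorem peel_subset {ι V : Type*} [DecidableEq ι] [Fintype ι] [LinearOrder V] (p : ι)
    (A : Finset (ι → V)) : peel p A ⊆ A :=
  Finset.filter_subset _ _

theorem eq_of_mem_sdiff_peel {ι V : Type*} [DecidableEq ι] [Fintype ι] [LinearOrder V] {p : ι}
    {A : Finset (ι → V)} {f g : ι → V} (hf : f ∈ A \ peel p A) (hg : g ∈ A \ peel p A)
    (h : ∀ q, q ≠ p → f q = g q) : f = g := by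
  simp only [peel, Finset.mem_sdiff, Finset.mem_filter, not_and, not_exists] at hf hg
  funext q
  by_cases hq : q = p
  · subst hq
    apply le_antisymm
    · by_contra hlt
      exact hf.2 hf.1 g hg.1 (fun q' hq' => (h q' hq').symm) (not_le.1 hlt)
    · by_contra hlt
      exact hg.2 hg.1 f hf.1 h (not_le.1 hlt)
  · exact h q hq

/-- Peel successively along the coordinates `0, 1, 2, …` modulo `r`. -/
def iterPeel {V : Type*} [LinearOrder V] {r : ℕ} [NeZero r] (A : Finset (Fin r → V)) :
    ℕ → Finset (Fin r → V)
  | 0 => A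
  | j + 1 => peel (Fin.ofNat r j) (iterPeel A j)

theorem iterPeel_subset {V : Type*} [LinearOrder V] {r : ℕ} [NeZero r] (A : Finset (Fin r → V))
    (j : ℕ) : iterPeel A j ⊆ A := by
  induction j with
  | zero => exact subset_rfl
  | succ j ih => exact (peel_subset _ _).trans ih

theorem card_le_sum_sdiff_peel {V : Type*} [LinearOrder V] {r : ℕ} [NeZero r]
    (A : Finset (Fin r → V)) (j : ℕ) :
    A.card ≤ (∑ i ∈ Finset.range j,
      (iterPeel A i \ peel (Fin.ofNat r i) (iterPeel A i)).card) + (iterPeel A j).card := by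
  induction j with
  | zero => simp [iterPeel]
  | succ j ih =>
    rw [Finset.sum_range_succ]
    have := Finset.card_sdiff_add_card_eq_card (peel_subset (Fin.ofNat r j) (iterPeel A j))
    simp only [iterPeel]
    omega

/-- `F 0, …, F (k - 1)` are tuples such that `F (i + 1)` arises from `F i` by increasing the
coordinate `i` modulo `r`. -/
structure IsStepSequence {V : Type*} [LinearOrder V] {r : ℕ} [NeZero r] (k : ℕ)
    (F : ℕ → Fin r → V) : Prop where
  eq_off : ∀ i, i + 1 < k → ∀ q, q ≠ Fin.ofNat r i → F (i + 1) q = F i q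
  lt_step : ∀ i, i + 1 < k → F i (Fin.ofNat r i) < F (i + 1) (Fin.ofNat r i)

/-- Each survivor of a round has a witness below it that survived the previous round; following
witnesses backwards builds the sequence. -/
theorem exists_isStepSequence {V : Type*} [LinearOrder V] {r : ℕ} [NeZero r]
    {A : Finset (Fin r → V)} {j : ℕ} {f : Fin r → V} (hf : f ∈ iterPeel A j) :
    ∃ F : ℕ → Fin r → V, IsStepSequence (j + 1) F ∧ (∀ i < j + 1, F i ∈ A) ∧ F j = f := by
  induction j generalizing f with
  | zero =>
    refine ⟨fun _ => f, ⟨fun i hi => by omega, fun i hi => by omega⟩, fun _ _ => ?_, rfl⟩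
    exact hf
  | succ j ih =>
    simp only [iterPeel, peel, Finset.mem_filter] at hf
    obtain ⟨hfA, g, hg, hoff, hlt⟩ := hf
    obtain ⟨F, hF, hmem, hFj⟩ := ih hg
    refine ⟨fun i => if i = j + 1 then f else F i, ⟨fun i hi q hq => ?_, fun i hi => ?_⟩,
      fun i hi => ?_, by simp⟩
    · by_cases h : i = j
      · subst h
        simp [hFj, hoff q hq]
      · have h1 : i ≠ j + 1 := by omega
        simp only [Nat.add_right_cancel_iff, h, h1, if_false]
        exact hF.eq_off i (by omega) q hq
    · by_cases h : i = j
      · subst h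
        simpa [hFj] using hlt
      · have h1 : i ≠ j + 1 := by omega
        simp only [Nat.add_right_cancel_iff, h, h1, if_false]
        exact hF.lt_step i (by omega)
    · by_cases h : i = j + 1
      · simpa [h] using iterPeel_subset A j hfA
      · simpa [h] using hmem i (by omega)

theorem IsStepSequence.eq_of_forall_ne {V : Type*} [LinearOrder V] {r : ℕ} [NeZero r] {k : ℕ}
    {F : ℕ → Fin r → V} (hF : IsStepSequence k F) (q : Fin r) {a b : ℕ} (hab : a ≤ b) (hb : b < k)
    (h : ∀ s, a ≤ s → s < b → s % r ≠ q) : F b q = F a q := by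
  induction b, hab using Nat.le_induction with
  | base => rfl
  | succ b hab ih =>
    rw [hF.eq_off b hb q, ih (by omega) fun s h1 h2 => h s h1 (by omega)]
    intro hq
    apply h b hab (by omega)
    rw [hq]
    simp

/-! ### Crossing orders and paths read off from step sequences -/

theorem IsCrossingOrder.first_le {V : Type*} [LinearOrder V] {r k : ℕ} {v : ℕ → V}
    (h : IsCrossingOrder r k v) {i j : ℕ} (hij : i ≤ j) (hj : j < r) : v i ≤ v j := by
  induction j, hij using Nat.le_induction with
  | base => exact le_rfl
  | succ j hij ih => exact (ih (by omega)).trans (h.first j hj).le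

theorem IsCrossingOrder.chain_strict {V : Type*} [LinearOrder V] {r k : ℕ} {v : ℕ → V}
    (h : IsCrossingOrder r k v) {j m m' : ℕ} (hj : j < r) (hm : m < m')
    (hlt : j + m' * r < r + k - 1) : v (j + m * r) < v (j + m' * r) := by
  have step : ∀ m, j + (m + 1) * r < r + k - 1 → v (j + m * r) < v (j + (m + 1) * r) := by
    intro m hm
    by_cases hjr : j + 1 < r
    · exact h.chain j hjr m hm
    · obtain rfl : j = r - 1 := by omega
      exact h.last m hm
  induction m', hm using Nat.le_induction with
  | base => exact step m hlt
  | succ m' hm ih =>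
    have : m' * r ≤ (m' + 1) * r := Nat.mul_le_mul_right _ (by omega)
    exact (ih (by omega)).trans (step m' hlt)

/-- Each residue class modulo `r` lies wholly below the next one: chain `j` stays under `v (j + 1)`,
and chain `j'` never drops below its start `v j'`. -/
theorem IsCrossingOrder.lt_of_residue_lt {V : Type*} [LinearOrder V] {r k : ℕ} {v : ℕ → V}
    (h : IsCrossingOrder r k v) {j j' m m' : ℕ} (hjj : j < j') (hj' : j' < r)
    (hm : j + m * r < r + k - 1) (hm' : j' + m' * r < r + k - 1) :
    v (j + m * r) < v (j' + m' * r) := by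
  refine (h.chain_lt j (by omega) m hm).trans_le ((h.first_le hjj hj').trans ?_)
  rcases Nat.eq_zero_or_pos m' with rfl | hpos
  · simp
  · simpa using (h.chain_strict (m := 0) hj' hpos hm').le

theorem IsCrossingOrder.injOn {V : Type*} [LinearOrder V] {r k : ℕ} {v : ℕ → V} (hr : 0 < r)
    (h : IsCrossingOrder r k v) : Set.InjOn v (Set.Iio (r + k - 1)) := by
  intro a ha b hb hab
  simp only [Set.mem_Iio] at ha hb
  have ea : a % r + a / r * r = a := Nat.mod_add_div' a r
  have eb : b % r + b / r * r = b := Nat.mod_add_div' b r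
  rw [← ea] at ha hab ⊢
  rw [← eb] at hb hab ⊢
  rcases lt_trichotomy (a % r) (b % r) with hlt | heq | hlt
  · exact absurd hab (h.lt_of_residue_lt hlt (Nat.mod_lt _ hr) ha hb).ne
  · rw [heq] at ha hab ⊢
    rcases lt_trichotomy (a / r) (b / r) with hd | hd | hd
    · exact absurd hab (h.chain_strict (Nat.mod_lt _ hr) hd hb).ne
    · rw [hd]
    · exact absurd hab (h.chain_strict (Nat.mod_lt _ hr) hd ha).ne'
  · exact absurd hab (h.lt_of_residue_lt hlt (Nat.mod_lt _ hr) hb ha).ne'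

/-- The path lists the entries of `F 0` and then each newly raised entry: `v i = F (i + 1 - r) (i
mod r)`, where truncated subtraction gives `F 0` for `i < r`. -/
theorem IsStepSequence.containsCrossingPath {V : Type*} [LinearOrder V] {r : ℕ} [NeZero r] {k : ℕ}
    {F : ℕ → Fin r → V} (hF : IsStepSequence k F) (hr : 2 ≤ r) (hk : 1 ≤ k)
    (H : Finset (Finset V)) (hmem : ∀ i < k, Finset.univ.image (F i) ∈ H)
    (hsep : ∀ i < k, ∀ q q' : Fin r, q < q' → F i q < F 0 q') : ContainsCrossingPath r k H := by
  -- Coordinate `i mod r` is not touched between times `i + 1 - r` and `t`, so the window of `r`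
  -- vertices starting at `t` spells out `F t`.
  have hv : ∀ t i, t < k → t ≤ i → i < t + r →
      F (i + 1 - r) (Fin.ofNat r i) = F t (Fin.ofNat r i) := by
    intro t i ht hti hit
    refine (hF.eq_of_forall_ne _ (by omega) ht fun s h1 h2 hs => ?_).symm
    rw [Fin.val_ofNat] at hs
    have := (Nat.modEq_iff_dvd' (show s ≤ i by omega)).1 hs
    exact absurd (Nat.le_of_dvd (by omega) this) (by omega)
  have hofNat : ∀ j m, Fin.ofNat r (j + m * r) = Fin.ofNat r j := by
    intro j m
    ext
    simp
  have hstep : ∀ i, i + r < r + k - 1 →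
      F (i + 1 - r) (Fin.ofNat r i) < F (i + r + 1 - r) (Fin.ofNat r (i + r)) := by
    intro i hi
    have e : Fin.ofNat r (i + r) = Fin.ofNat r i := by simpa using hofNat i 1
    rw [hv i i (by omega) le_rfl (by omega), e, show i + r + 1 - r = i + 1 by omega]
    exact hF.lt_step i (by omega)
  have hchain : ∀ j m, j + (m + 1) * r < r + k - 1 →
      F (j + m * r + 1 - r) (Fin.ofNat r (j + m * r)) <
        F (j + (m + 1) * r + 1 - r) (Fin.ofNat r (j + (m + 1) * r)) := by
    intro j m hm
    have e : j + (m + 1) * r = j + m * r + r := by ring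
    rw [e] at hm ⊢
    exact hstep _ hm
  have hzero : ∀ j < r, F (j + 1 - r) (Fin.ofNat r j) = F 0 (Fin.ofNat r j) := by
    intro j hj
    rw [show j + 1 - r = 0 by omega]
  have hofNat_lt : ∀ i j, i < j → j < r → Fin.ofNat r i < Fin.ofNat r j := by
    intro i j hij hj
    rw [Fin.lt_def, Fin.val_ofNat, Fin.val_ofNat, Nat.mod_eq_of_lt hj, Nat.mod_eq_of_lt (by omega)]
    exact hij
  have hord : IsCrossingOrder r k fun i => F (i + 1 - r) (Fin.ofNat r i) := by
    refine ⟨fun j hj => ?_, fun j _ m hm => hchain j m hm, fun j hj m hm => ?_, ?_,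
      fun m hm => hchain _ m hm⟩
    · rw [hzero _ hj, hzero _ (by omega)]
      exact hsep 0 hk _ _ (hofNat_lt _ _ (by omega) hj)
    · rw [hzero _ hj, hofNat]
      exact hsep _ (by omega) _ _ (hofNat_lt _ _ (by omega) hj)
    · rw [hzero _ (by omega), hzero _ (by omega)]
      exact hsep 0 hk _ _ (hofNat_lt _ _ (by omega) (by omega))
  refine ⟨_, ⟨hord.injOn (by omega), fun t ht => ?_⟩, hord⟩
  convert hmem t ht using 1
  ext x
  simp only [Finset.mem_image, Finset.mem_Ico, Finset.mem_univ, true_and]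
  constructor
  · rintro ⟨i, ⟨h1, h2⟩, rfl⟩
    exact ⟨_, (hv t i ht h1 h2).symm⟩
  · rintro ⟨q, rfl⟩
    have hq : (q : ℕ) ∈ (Finset.Ico t (t + r)).image (· % r) := by
      rw [Nat.image_Ico_mod]
      simp
    obtain ⟨i, hi, hiq⟩ := Finset.mem_image.1 hq
    rw [Finset.mem_Ico] at hi
    have e : Fin.ofNat r i = q := by
      ext
      simpa using hiq
    refine ⟨i, hi, ?_⟩
    rw [hv t i ht hi.1 hi.2, e]

/-! ### Counting increasing tuples with prescribed gaps -/

/-- Removing the forced slack `s q` from the entries indexed by `T` leaves a strictly increasing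
tuple below `N`, which is recovered from its image. -/
theorem card_le_choose_of_shift {ι : Type*} [Fintype ι] [LinearOrder ι] {n N : ℕ} (T : Finset ι)
    (s : ι → ℕ) (S : Finset (ι → Fin n)) (hle : ∀ f ∈ S, ∀ q ∈ T, s q ≤ f q)
    (hmono : ∀ f ∈ S, ∀ q ∈ T, ∀ q' ∈ T, q < q' → (f q : ℕ) - s q < f q' - s q')
    (hlt : ∀ f ∈ S, ∀ q ∈ T, (f q : ℕ) - s q < N)
    (hinj : ∀ f ∈ S, ∀ g ∈ S, (∀ q ∈ T, f q = g q) → f = g) : S.card ≤ N.choose T.card := by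
  have hsm : ∀ f ∈ S, StrictMono fun q : T => (f q : ℕ) - s q := fun f hf q q' hqq =>
    hmono f hf q q.2 q' q'.2 hqq
  rw [← Finset.card_range N, ← Finset.card_powersetCard]
  refine Finset.card_le_card_of_injOn (fun f => T.image fun q => (f q : ℕ) - s q) ?_ ?_
  · intro f hf
    rw [Finset.mem_coe, Finset.mem_powersetCard]
    constructor
    · intro x hx
      obtain ⟨q, hq, rfl⟩ := Finset.mem_image.1 hx
      exact Finset.mem_range.2 (hlt f hf q hq)
    · refine Finset.card_image_of_injOn fun q hq q' hq' h => ?_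
      exact congrArg Subtype.val ((hsm f hf).injective (a₁ := ⟨q, hq⟩) (a₂ := ⟨q', hq'⟩) h)
  · intro f hf g hg hfg
    refine hinj f hf g hg fun q hq => ?_
    have hrange : Set.range (fun q : T => (f q : ℕ) - s q) =
        Set.range fun q : T => (g q : ℕ) - s q := by
      ext x
      have := Finset.ext_iff.1 hfg x
      simpa using this
    have h1 := congrFun (((hsm f hf).range_inj (hsm g hg)).1 hrange) ⟨q, hq⟩
    have h2 := hle f hf q hq
    have h3 := hle g hg q hq
    ext
    simp only at h1
    omega

theorem add_mul_sub_le_of_adjacent {r : ℕ} {f : Fin r → ℕ} {c j : ℕ}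
    (h : ∀ q q' : Fin r, (q : ℕ) + 1 = q' → (q' : ℕ) < j → f q + c ≤ f q') {q q' : Fin r}
    (hqq : q ≤ q') (hj : (q' : ℕ) < j) : f q + c * (q' - q : ℕ) ≤ f q' := by
  obtain ⟨q, hq⟩ := q
  obtain ⟨q', hq'⟩ := q'
  rw [Fin.mk_le_mk] at hqq
  simp only at hj ⊢
  induction q', hqq using Nat.le_induction with
  | base => simp
  | succ m hm ih =>
    have h1 := ih (by omega) (by omega)
    have h2 := h ⟨m, by omega⟩ ⟨m + 1, hq'⟩ rfl hj
    rw [show m + 1 - q = (m - q) + 1 by omega, Nat.mul_succ]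
    omega

theorem StrictMono.add_sub_le {r n : ℕ} {f : Fin r → Fin n} (hf : StrictMono f) {q q' : Fin r}
    (hqq : q ≤ q') : (f q : ℕ) + (q' - q : ℕ) ≤ f q' := by
  simpa using add_mul_sub_le_of_adjacent (f := fun q => (f q : ℕ)) (c := 1) (j := r)
    (fun a b hab _ => hf (Fin.lt_def.2 (by omega))) hqq q'.2

/-! ### Edges as increasing tuples -/

open Classical in
/-- The edges of `H`, listed in increasing order. -/
noncomputable def edgeTuples {n : ℕ} (r : ℕ) (H : Finset (Finset (Fin n))) :
    Finset (Fin r → Fin n) :=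
  Finset.univ.filter fun f => StrictMono f ∧ Finset.univ.image f ∈ H

theorem mem_edgeTuples {n r : ℕ} {H : Finset (Finset (Fin n))} {f : Fin r → Fin n} :
    f ∈ edgeTuples r H ↔ StrictMono f ∧ Finset.univ.image f ∈ H := by
  simp [edgeTuples]

theorem exists_strictMono_image_eq {n r : ℕ} {e : Finset (Fin n)} (he : e.card = r) :
    ∃ f : Fin r → Fin n, StrictMono f ∧ Finset.univ.image f = e := by
  refine ⟨e.orderEmbOfFin he, (e.orderEmbOfFin he).strictMono, ?_⟩
  apply Finset.coe_injective
  simp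

theorem card_le_card_edgeTuples {n r : ℕ} {H : Finset (Finset (Fin n))}
    (hH : IsOrderedRGraph r H) : H.card ≤ (edgeTuples r H).card := by
  refine (Finset.card_le_card fun e he => ?_).trans
    (Finset.card_image_le (f := fun f => Finset.univ.image f))
  obtain ⟨f, hf, rfl⟩ := exists_strictMono_image_eq (hH e he)
  exact Finset.mem_image.2 ⟨f, mem_edgeTuples.2 ⟨hf, he⟩, rfl⟩

theorem le_exOrderedCrossingPath {n r k : ℕ} {H : Finset (Finset (Fin n))}
    (hH : IsOrderedRGraph r H) (hP : ¬ ContainsCrossingPath r k H) :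
    H.card ≤ exOrderedCrossingPath n r k := by
  classical
  exact Finset.le_sup (f := Finset.card) (Finset.mem_filter.2 ⟨Finset.mem_univ _, hH, hP⟩)

theorem exOrderedCrossingPath_le {n r k m : ℕ} (h : ∀ H : Finset (Finset (Fin n)),
    IsOrderedRGraph r H → ¬ ContainsCrossingPath r k H → H.card ≤ m) :
    exOrderedCrossingPath n r k ≤ m := by
  classical
  refine Finset.sup_le fun H hH => ?_
  obtain ⟨_, h1, h2⟩ := Finset.mem_filter.1 hH
  exact h H h1 h2

/-! ### Short paths: upper bound -/

/-- After peeling along the first `j` coordinates, the first `j` gaps (starting with the one before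
the least element) are nontrivial. -/
theorem gaps_of_mem_iterPeel {n r : ℕ} [NeZero r] {A : Finset (Fin r → Fin n)}
    (hA : ∀ f ∈ A, StrictMono f) {j : ℕ} (hj : j ≤ r) {f : Fin r → Fin n}
    (hf : f ∈ iterPeel A j) (q : Fin r) (hq : (q : ℕ) < j) :
    ((q : ℕ) = 0 → 1 ≤ (f q : ℕ)) ∧ ∀ q' : Fin r, (q' : ℕ) + 1 = q → (f q' : ℕ) + 2 ≤ f q := by
  induction j generalizing f q with
  | zero => omega
  | succ j ih =>
    simp only [iterPeel, peel, Finset.mem_filter] at hf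
    obtain ⟨hfA, g, hg, hoff, hlt⟩ := hf
    have hval : ((Fin.ofNat r j : Fin r) : ℕ) = j := by
      rw [Fin.val_ofNat, Nat.mod_eq_of_lt (by omega)]
    by_cases hqj : (q : ℕ) = j
    · have hq' : Fin.ofNat r j = q := Fin.ext (by omega)
      rw [hq'] at hlt hoff
      rw [Fin.lt_def] at hlt
      refine ⟨fun _ => by omega, fun q' hq' => ?_⟩
      have h1 := hA g (iterPeel_subset A j hg) (show q' < q from Fin.lt_def.2 (by omega))
      rw [hoff q' (fun h => by rw [h] at hq'; omega), Fin.lt_def] at h1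
      omega
    · exact ih (by omega) hfA q (by omega)

/-- A deleted tuple is determined by its entries off `j`, and these still carry the slack created by
the `j` earlier rounds. -/
theorem card_sdiff_peel_le_choose {n r : ℕ} [NeZero r] {A : Finset (Fin r → Fin n)}
    (hA : ∀ f ∈ A, StrictMono f) {j : ℕ} (hj : j < r) :
    (iterPeel A j \ peel (Fin.ofNat r j) (iterPeel A j)).card ≤ (n - j - 1).choose (r - 1) := by
  have hval : ((Fin.ofNat r j : Fin r) : ℕ) = j := by
    rw [Fin.val_ofNat, Nat.mod_eq_of_lt (by omega)]
  have hne : ∀ q : Fin r, q ∈ Finset.univ.erase (Fin.ofNat r j) → (q : ℕ) ≠ j := by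
    intro q hq h
    exact (Finset.mem_erase.1 hq).1 (Fin.ext (by omega))
  have hcard : (Finset.univ.erase (Fin.ofNat r j) : Finset (Fin r)).card = r - 1 := by
    rw [Finset.card_erase_of_mem (Finset.mem_univ _), Finset.card_univ, Fintype.card_fin]
  have hgap : ∀ f ∈ iterPeel A j, ∀ q q' : Fin r, q ≤ q' → (q' : ℕ) < j →
      (f q : ℕ) + 2 * (q' - q : ℕ) ≤ f q' := fun f hf q q' hqq hq' =>
    add_mul_sub_le_of_adjacent (f := fun q => (f q : ℕ))
      (fun a b hab hb => (gaps_of_mem_iterPeel hA hj.le hf b hb).2 a hab) hqq hq'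
  have hpos : ∀ f ∈ iterPeel A j, 0 < j → 1 ≤ (f ⟨0, by omega⟩ : ℕ) := fun f hf h =>
    (gaps_of_mem_iterPeel hA hj.le hf ⟨0, by omega⟩ h).1 rfl
  rw [← hcard]
  have hle : ∀ f ∈ iterPeel A j, ∀ q : Fin r, (q : ℕ) ≠ j → min (q : ℕ) j + 1 ≤ f q := by
    intro f hf q hq
    have hmono := hA f (iterPeel_subset A j hf)
    rcases Nat.eq_zero_or_pos j with rfl | hj0
    · have := hmono.add_sub_le (q := ⟨0, by omega⟩) (q' := q) (Fin.le_def.2 (by simp))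
      simp only at this
      omega
    · have h0 := hpos f hf hj0
      rcases lt_or_gt_of_ne hq with h | h
      · have := hgap f hf ⟨0, by omega⟩ q (Fin.le_def.2 (by simp)) h
        simp only at this
        omega
      · have h1 := hgap f hf ⟨0, by omega⟩ ⟨j - 1, by omega⟩ (Fin.le_def.2 (by simp))
          (by simp only; omega)
        have h2 := hmono.add_sub_le (q := ⟨j - 1, by omega⟩) (q' := q)
          (Fin.le_def.2 (by simp only; omega))
        simp only at h1 h2
        omega
  have hmem : ∀ f ∈ iterPeel A j \ peel (Fin.ofNat r j) (iterPeel A j), f ∈ iterPeel A j :=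
    fun f hf => (Finset.mem_sdiff.1 hf).1
  -- An entry `q < j` has `q + 1` widened gaps before it; an entry `q > j` has `j` of them, plus the
  -- place vacated by coordinate `j`.
  refine card_le_choose_of_shift _ (fun q : Fin r => min (q : ℕ) j + 1) _
    (fun f hf q hq => hle f (hmem f hf) q (hne q hq)) (fun f hf q hq q' hq' hqq => ?_)
    (fun f hf q hq => ?_) (fun f hf g hg h => eq_of_mem_sdiff_peel hf hg fun q hq =>
      h q (Finset.mem_erase.2 ⟨hq, Finset.mem_univ _⟩))
  · replace hf := hmem f hf
    have hmono := hA f (iterPeel_subset A j hf)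
    have l1 := hle f hf q (hne q hq)
    have l2 := hle f hf q' (hne q' hq')
    have n1 := hne q hq
    have n2 := hne q' hq'
    rw [Fin.lt_def] at hqq
    rcases lt_or_gt_of_ne n2 with h | h
    · have := hgap f hf q q' (Fin.le_def.2 hqq.le) h
      omega
    · rcases lt_or_gt_of_ne n1 with h' | h'
      · have h1 := hgap f hf q ⟨j - 1, by omega⟩ (Fin.le_def.2 (by simp only; omega))
          (by simp only; omega)
        have h2 := hmono.add_sub_le (q := ⟨j - 1, by omega⟩) (q' := q')
          (Fin.le_def.2 (by simp only; omega))
        simp only at h1 h2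
        omega
      · have := hmono.add_sub_le (q := q) (q' := q') (Fin.le_def.2 hqq.le)
        omega
  · replace hf := hmem f hf
    have hmono := hA f (iterPeel_subset A j hf)
    have l1 := hle f hf q (hne q hq)
    have b1 := (f q).2
    rcases lt_or_gt_of_ne (hne q hq) with h | h
    · have := hmono.add_sub_le (q := q) (q' := ⟨j, hj⟩) (Fin.le_def.2 h.le)
      have b2 := (f ⟨j, hj⟩).2
      simp only at this
      omega
    · omega

theorem sum_choose_add_choose {n m r : ℕ} (hr : 1 ≤ r) (hm : m ≤ n) :
    ∑ j ∈ Finset.range m, (n - j - 1).choose (r - 1) + (n - m).choose r = n.choose r := by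
  induction m with
  | zero => simp
  | succ m ih =>
    rw [← ih (by omega), Finset.sum_range_succ]
    obtain ⟨r, rfl⟩ := Nat.exists_eq_add_of_le' hr
    rw [show n - m = (n - (m + 1)) + 1 by omega, Nat.choose_succ_succ',
      show n - (m + 1) + 1 - 1 = n - (m + 1) by omega, Nat.add_sub_cancel]
    omega

/-- A step sequence of at most `r + 1` increasing `r`-tuples keeps its coordinates separated. -/
theorem IsStepSequence.lt_of_le_succ {V : Type*} [LinearOrder V] {r k : ℕ} [NeZero r]
    {F : ℕ → Fin r → V} (hF : IsStepSequence k F) (hk : k ≤ r + 1)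
    (hmono : ∀ i < k, StrictMono (F i)) {i : ℕ} (hi : i < k) {q q' : Fin r} (hqq : q < q') :
    F i q < F 0 q' := by
  have hlt := Fin.lt_def.1 hqq
  -- Compare at time `min i q'`: coordinate `q` has already made its only possible move up to time
  -- `i`, while `q'` has not yet moved.
  have e1 : F i q = F (min i q') q := by
    refine hF.eq_of_forall_ne q (min_le_left _ _) hi fun s h1 h2 hs => ?_
    rw [Nat.mod_eq_of_lt (by omega)] at hs
    omega
  have e2 : F (min i q') q' = F 0 q' := by
    refine hF.eq_of_forall_ne q' (Nat.zero_le _) (by omega) fun s h1 h2 hs => ?_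
    rw [Nat.mod_eq_of_lt (by omega)] at hs
    omega
  rw [e1, ← e2]
  exact hmono _ (by omega) hqq

theorem card_le_of_not_containsCrossingPath {n r k : ℕ} (hk : 1 ≤ k) (hr : 2 ≤ r)
    (hkr : k ≤ r + 1) (hn : r + k ≤ n) {H : Finset (Finset (Fin n))} (hH : IsOrderedRGraph r H)
    (hP : ¬ ContainsCrossingPath r k H) :
    H.card ≤ n.choose r - (n - k + 1).choose r := by
  have : NeZero r := ⟨by omega⟩
  have hA : ∀ f ∈ edgeTuples r H, StrictMono f := fun f hf => (mem_edgeTuples.1 hf).1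
  have hempty : iterPeel (edgeTuples r H) (k - 1) = ∅ := by
    refine Finset.eq_empty_of_forall_notMem fun f hf => hP ?_
    obtain ⟨F, hF, hmem, -⟩ := exists_isStepSequence hf
    rw [Nat.sub_add_cancel hk] at hF hmem
    exact hF.containsCrossingPath hr hk H (fun i hi => (mem_edgeTuples.1 (hmem i hi)).2)
      fun i hi q q' hqq => hF.lt_of_le_succ hkr (fun i hi => hA _ (hmem i hi)) hi hqq
  have h1 := card_le_card_edgeTuples hH
  have h2 := card_le_sum_sdiff_peel (edgeTuples r H) (k - 1)
  rw [hempty, Finset.card_empty] at h2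
  have h3 : ∑ i ∈ Finset.range (k - 1), (iterPeel (edgeTuples r H) i \
      peel (Fin.ofNat r i) (iterPeel (edgeTuples r H) i)).card ≤
      ∑ i ∈ Finset.range (k - 1), (n - i - 1).choose (r - 1) :=
    Finset.sum_le_sum fun i hi =>
      card_sdiff_peel_le_choose hA (by have := Finset.mem_range.1 hi; omega)
  have h4 := sum_choose_add_choose (n := n) (m := k - 1) (r := r) (by omega) (by omega)
  rw [show n - k + 1 = n - (k - 1) by omega]
  omega

/-! ### Short paths: lower bound -/

open Classical in
/-- Increasing `r`-tuples whose first `m` gaps are nontrivial; the `r`-th gap is the one after the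
greatest element. -/
noncomputable def gappedTuples (n r m : ℕ) : Finset (Fin r → Fin n) :=
  Finset.univ.filter fun f => StrictMono f ∧ ∀ q : Fin r, (q : ℕ) < m →
    (∀ q' : Fin r, (q : ℕ) + 1 = q' → (f q : ℕ) + 2 ≤ f q') ∧
      ((q : ℕ) + 1 = r → (f q : ℕ) + 2 ≤ n)

theorem card_gappedTuples_le {n r m : ℕ} (hm : m ≤ r) :
    (gappedTuples n r m).card ≤ (n - m).choose r := by
  have hmem : ∀ f ∈ gappedTuples n r m, StrictMono f ∧ ∀ q : Fin r, (q : ℕ) < m →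
      (∀ q' : Fin r, (q : ℕ) + 1 = q' → (f q : ℕ) + 2 ≤ f q') ∧
        ((q : ℕ) + 1 = r → (f q : ℕ) + 2 ≤ n) := fun f hf => (Finset.mem_filter.1 hf).2
  have hgap : ∀ f ∈ gappedTuples n r m, ∀ q q' : Fin r, q ≤ q' → (q' : ℕ) < m + 1 →
      (f q : ℕ) + 2 * (q' - q : ℕ) ≤ f q' := fun f hf q q' hqq hq' =>
    add_mul_sub_le_of_adjacent (f := fun q => (f q : ℕ))
      (fun a b hab hb => ((hmem f hf).2 a (by omega)).1 b hab) hqq hq'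
  have hle : ∀ f ∈ gappedTuples n r m, ∀ q : Fin r, (q : ℕ) ≤ f q := fun f hf q => by
    have := (hmem f hf).1.add_sub_le (q := ⟨0, q.pos⟩) (q' := q) (Fin.le_def.2 (by simp))
    simp only at this
    omega
  have hcard : (Finset.univ : Finset (Fin r)).card = r := by simp
  conv_rhs => rw [← hcard]
  refine card_le_choose_of_shift _ (fun q : Fin r => min (q : ℕ) m) _
    (fun f hf q _ => (min_le_left _ _).trans (hle f hf q)) (fun f hf q _ q' _ hqq => ?_)
    (fun f hf q _ => ?_) fun f _ g _ h => funext fun q => h q (Finset.mem_univ q)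
  · have l1 := hle f hf q
    have l2 := hle f hf q'
    rw [Fin.lt_def] at hqq
    rcases lt_or_ge (q' : ℕ) (m + 1) with h | h
    · have := hgap f hf q q' (Fin.le_def.2 hqq.le) h
      omega
    · rcases lt_or_ge (q : ℕ) m with h' | h'
      · have h1 := hgap f hf q ⟨m, by omega⟩ (Fin.le_def.2 (by simp only; omega))
          (by simp only; omega)
        have h2 := (hmem f hf).1.add_sub_le (q := ⟨m, by omega⟩) (q' := q')
          (Fin.le_def.2 (by simp only; omega))
        simp only at h1 h2
        omega
      · have := (hmem f hf).1.add_sub_le (q := q) (q' := q') (Fin.le_def.2 hqq.le)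
        omega
  · have l1 := hle f hf q
    have b1 := (f q).2
    rcases lt_or_ge (q : ℕ) m with h | h
    · rcases lt_or_eq_of_le hm with h' | h'
      · have h1 := hgap f hf q ⟨m, h'⟩ (Fin.le_def.2 h.le) (by simp only; omega)
        have b2 := (f ⟨m, h'⟩).2
        simp only at h1
        omega
      · have h1 := hgap f hf q ⟨m - 1, by omega⟩ (Fin.le_def.2 (by simp only; omega))
          (by simp only; omega)
        have h2 := ((hmem f hf).2 ⟨m - 1, by omega⟩ (by simp only; omega)).2 (by simp only; omega)
        simp only at h1
        omega
    · omega

theorem le_exOrderedCrossingPath_of_le_succ {n r k : ℕ} (hk : 1 ≤ k) (hr : 2 ≤ r)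
    (hkr : k ≤ r + 1) (hn : r + k ≤ n) :
    n.choose r - (n - k + 1).choose r ≤ exOrderedCrossingPath n r k := by
  classical
  set H : Finset (Finset (Fin n)) := Finset.powersetCard r Finset.univ \
    (gappedTuples n r (k - 1)).image fun f => Finset.univ.image f
  have hcard : n.choose r - (n - k + 1).choose r ≤ H.card := by
    refine le_trans ?_ (Finset.le_card_sdiff _ _)
    rw [Finset.card_powersetCard, Finset.card_univ, Fintype.card_fin]
    refine Nat.sub_le_sub_left (Finset.card_image_le.trans ?_) _
    rw [show n - k + 1 = n - (k - 1) by omega]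
    exact card_gappedTuples_le (by omega)
  refine hcard.trans (le_exOrderedCrossingPath (fun e he => ?_) ?_)
  · exact (Finset.mem_powersetCard.1 (Finset.mem_sdiff.1 he).1).2
  · rintro ⟨v, ⟨-, hedge⟩, hord⟩
    have h0 := hedge 0 hk
    refine (Finset.mem_sdiff.1 h0).2 (Finset.mem_image.2 ⟨fun q => v q, ?_, ?_⟩)
    -- The vertex `v (q + r)` lies strictly between `v q` and `v (q + 1)`, or above `v (r - 1)` when
    -- `q = r - 1`, so the gap after `v q` is nontrivial.
    · refine Finset.mem_filter.2 ⟨Finset.mem_univ _, fun a b hab => ?_, fun q hq => ⟨?_, ?_⟩⟩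
      · exact (hord.first a (by have := Fin.lt_def.1 hab; omega)).trans_le
          (hord.first_le (Fin.lt_def.1 hab) b.2)
      · intro q' hq'
        have h1 := hord.chain q (by omega) 0 (by omega)
        have h2 := hord.chain_lt q (by omega) 1 (by omega)
        simp only [zero_mul, add_zero, zero_add] at h1
        rw [Fin.lt_def] at h1 h2
        change (v q : ℕ) + 2 ≤ v q'
        rw [← hq']
        omega
      · intro hq'
        have h1 := hord.last 0 (by omega)
        have b := (v (r - 1 + (0 + 1) * r)).2
        rw [zero_mul, add_zero, Fin.lt_def] at h1
        change (v q : ℕ) + 2 ≤ n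
        rw [show (q : ℕ) = r - 1 by omega]
        omega
    · ext x
      simp only [Finset.mem_image, Finset.mem_univ, true_and, Finset.mem_Ico, zero_le, zero_add]
      exact ⟨fun ⟨q, hq⟩ => ⟨q, q.2, hq⟩, fun ⟨i, hi, h⟩ => ⟨⟨i, hi⟩, h⟩⟩

/-! ### Long paths: upper bound by dyadic scales -/

theorem card_le_pow_of_eq_off {α : Type*} {r N : ℕ} (p : Fin r) (φ : α → Fin r → ℕ)
    (c : Fin r → ℕ) (S : Finset α) (hS : ∀ f ∈ S, ∀ q, c q ≤ φ f q ∧ φ f q < c q + N)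
    (hinj : ∀ f ∈ S, ∀ g ∈ S, (∀ q, q ≠ p → φ f q = φ g q) → f = g) : S.card ≤ N ^ (r - 1) := by
  have hcard : (Fintype.piFinset fun _ : {q : Fin r // q ≠ p} => Finset.range N).card =
      N ^ (r - 1) := by
    rw [Fintype.card_piFinset, Finset.prod_const, Finset.card_range, Finset.card_univ,
      Fintype.card_subtype_compl]
    simp
  rw [← hcard]
  refine Finset.card_le_card_of_injOn (fun f q => φ f q - c q) ?_ ?_
  · intro f hf
    rw [Finset.mem_coe, Fintype.mem_piFinset]
    intro q
    have := hS f hf q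
    rw [Finset.mem_range]
    change φ f q - c q < N
    omega
  · intro f hf g hg hfg
    refine hinj f hf g hg fun q hq => ?_
    have h1 := congrFun hfg ⟨q, hq⟩
    have h2 := (hS f hf q).1
    have h3 := (hS g hg q).1
    simp only at h1
    omega

/-- The entries of `f` lie in distinct dyadic blocks of length `2 ^ l`, two consecutive ones of them
in adjacent blocks. -/
def HasScale {r n : ℕ} (l : ℕ) (f : Fin r → Fin n) : Prop :=
  StrictMono (fun q => (f q : ℕ) / 2 ^ l) ∧
    ∃ q q' : Fin r, (q : ℕ) + 1 = q' ∧ (f q' : ℕ) / 2 ^ l = f q / 2 ^ l + 1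

/-- Take a scale that separates all entries while the next coarser one does not. Two consecutive
entries then merge on halving their block indices, so these indices differ by exactly one. -/
theorem exists_hasScale {r n : ℕ} (hr : 2 ≤ r) {f : Fin r → Fin n} (hf : StrictMono f) :
    ∃ l, 2 ^ l ≤ n ∧ HasScale l f := by
  have hbound : ∀ l, StrictMono (fun q => (f q : ℕ) / 2 ^ l) → 2 ^ l ≤ n := by
    intro l hl
    have h1 := hl (show (⟨0, by omega⟩ : Fin r) < ⟨1, hr⟩ from Fin.lt_def.2 (by simp))
    by_contra h
    have : (f ⟨1, hr⟩ : ℕ) / 2 ^ l = 0 := Nat.div_eq_of_lt (by have := (f ⟨1, hr⟩).2; omega)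
    simp only [this] at h1
    exact Nat.not_lt_zero _ h1
  have hex : ∃ l, StrictMono (fun q => (f q : ℕ) / 2 ^ l) ∧
      ¬ StrictMono (fun q => (f q : ℕ) / 2 ^ (l + 1)) := by
    by_contra! h
    have hall : ∀ l, StrictMono (fun q => (f q : ℕ) / 2 ^ l) := by
      intro l
      induction l with
      | zero => intro a b hab; simpa using hf hab
      | succ l ih => exact h l ih
    exact absurd (hbound n (hall n)) (not_le.2 Nat.lt_two_pow_self)
  obtain ⟨l, hl, hnot⟩ := hex
  refine ⟨l, hbound l hl, hl, ?_⟩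
  have hmono : Monotone fun q => (f q : ℕ) / 2 ^ (l + 1) := fun a b hab =>
    Nat.div_le_div_right (hf.monotone hab)
  simp only [StrictMono, not_forall, not_lt] at hnot
  obtain ⟨a, b, hab, hle⟩ := hnot
  rw [Fin.lt_def] at hab
  let a' : Fin r := ⟨a + 1, by omega⟩
  have haa' : a < a' := Fin.lt_def.2 (by simp [a'])
  have hab' : a' ≤ b := Fin.le_def.2 (by simp only [a']; omega)
  have h1 := hmono haa'.le
  have h2 := hmono hab'
  have h3 := hl haa'
  simp only [pow_succ, ← Nat.div_div_eq_div_mul] at h1 h2 h3 hle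
  exact ⟨a, a', rfl, by omega⟩

/-- With the block of every entry fixed, any two tuples are separated, so peeling applies for every
`k`; a round deletes at most one tuple per choice of `r - 1` positions inside blocks. -/
theorem card_le_of_block {n r k l : ℕ} (hr : 2 ≤ r) (hk : 1 ≤ k) {H : Finset (Finset (Fin n))}
    (hP : ¬ ContainsCrossingPath r k H) {B : Finset (Fin r → Fin n)} (hB : B ⊆ edgeTuples r H)
    {b : Fin r → ℕ} (hb : StrictMono b) (hBb : ∀ f ∈ B, ∀ q, (f q : ℕ) / 2 ^ l = b q) :
    B.card ≤ (k - 1) * (2 ^ l) ^ (r - 1) := by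
  have : NeZero r := ⟨by omega⟩
  have hempty : iterPeel B (k - 1) = ∅ := by
    refine Finset.eq_empty_of_forall_notMem fun f hf => hP ?_
    obtain ⟨F, hF, hmem, -⟩ := exists_isStepSequence hf
    rw [Nat.sub_add_cancel hk] at hF hmem
    refine hF.containsCrossingPath hr hk H
      (fun i hi => (mem_edgeTuples.1 (hB (hmem i hi))).2) fun i hi q q' hqq => ?_
    have h := hb hqq
    rw [← hBb _ (hmem i hi), ← hBb _ (hmem 0 hk)] at h
    exact Fin.lt_def.2 (Nat.lt_of_div_lt_div h)
  have h1 := card_le_sum_sdiff_peel B (k - 1)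
  rw [hempty, Finset.card_empty, add_zero] at h1
  refine h1.trans ((Finset.sum_le_card_nsmul _ _ ((2 ^ l) ^ (r - 1)) fun i _ => ?_).trans_eq
    (by simp))
  refine card_le_pow_of_eq_off (Fin.ofNat r i) (fun f q => (f q : ℕ)) (fun q => 2 ^ l * b q) _
    (fun f hf q => ?_) fun f hf g hg h => eq_of_mem_sdiff_peel hf hg fun q hq => Fin.ext (h q hq)
  rw [← hBb f (iterPeel_subset B i (Finset.mem_sdiff.1 hf).1) q]
  have h2 := Nat.div_add_mod (f q : ℕ) (2 ^ l)
  have h3 := Nat.mod_lt (f q : ℕ) (Nat.two_pow_pos l)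
  omega

/-- Adjacency of two blocks costs one degree of freedom; the factor `r` accounts for where the
adjacency occurs. -/
theorem card_image_block_le {n r l : ℕ} (S : Finset (Fin r → Fin n)) (hS : ∀ f ∈ S, HasScale l f) :
    (S.image fun f q => (f q : ℕ) / 2 ^ l).card ≤ r * (n / 2 ^ l + 1) ^ (r - 1) := by
  classical
  set T := S.image fun f q => (f q : ℕ) / 2 ^ l with hT
  have hsub : T ⊆ (Finset.univ : Finset (Fin r)).biUnion fun q' =>
      T.filter fun b => ∃ q : Fin r, (q : ℕ) + 1 = q' ∧ b q' = b q + 1 := by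
    intro b hb
    obtain ⟨f, hf, rfl⟩ := Finset.mem_image.1 hb
    obtain ⟨-, q, q', hqq, h⟩ := hS f hf
    exact Finset.mem_biUnion.2 ⟨q', Finset.mem_univ _, Finset.mem_filter.2 ⟨hb, q, hqq, h⟩⟩
  refine (Finset.card_le_card hsub).trans ((Finset.card_biUnion_le_card_mul _ _
    ((n / 2 ^ l + 1) ^ (r - 1)) fun q' _ => ?_).trans_eq (by simp))
  refine card_le_pow_of_eq_off q' id (fun _ => 0) _ (fun b hb q => ⟨Nat.zero_le _, ?_⟩) ?_
  · obtain ⟨f, -, rfl⟩ := Finset.mem_image.1 (Finset.mem_filter.1 hb).1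
    have : (f q : ℕ) / 2 ^ l ≤ n / 2 ^ l := Nat.div_le_div_right (f q).2.le
    simp only [id]
    omega
  · intro b hb c hc h
    obtain ⟨-, q, hq, hbq⟩ := Finset.mem_filter.1 hb
    obtain ⟨-, q₁, hq₁, hcq⟩ := Finset.mem_filter.1 hc
    obtain rfl : q = q₁ := Fin.ext (by omega)
    have hne : q ≠ q' := fun e => by rw [e] at hq; omega
    funext x
    by_cases hx : x = q'
    · rw [hx, hbq, hcq]
      exact congrArg (· + 1) (h q hne)
    · exact h x hx

theorem card_hasScale_le {n r k l : ℕ} (hr : 2 ≤ r) (hk : 1 ≤ k) {H : Finset (Finset (Fin n))}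
    (hP : ¬ ContainsCrossingPath r k H) (hl : 2 ^ l ≤ n) {S : Finset (Fin r → Fin n)}
    (hSH : S ⊆ edgeTuples r H) (hS : ∀ f ∈ S, HasScale l f) :
    S.card ≤ k * r * (2 * n) ^ (r - 1) := by
  classical
  have h1 := Finset.card_le_mul_card_image (f := fun (f : Fin r → Fin n) q => (f q : ℕ) / 2 ^ l) S
    ((k - 1) * (2 ^ l) ^ (r - 1)) fun b hb => by
      obtain ⟨f, hf, rfl⟩ := Finset.mem_image.1 hb
      refine card_le_of_block hr hk hP ((Finset.filter_subset _ _).trans hSH) (hS f hf).1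
        fun g hg q => ?_
      exact congrFun (Finset.mem_filter.1 hg).2 q
  -- The powers of `2 ^ l` from positions and from blocks cancel, so the bound does not depend on
  -- the scale.
  have h2 : 2 ^ l * (n / 2 ^ l + 1) ≤ 2 * n := by
    have := Nat.mul_div_le n (2 ^ l)
    rw [Nat.mul_add]
    omega
  calc S.card ≤ (k - 1) * (2 ^ l) ^ (r - 1) * (r * (n / 2 ^ l + 1) ^ (r - 1)) :=
        h1.trans (Nat.mul_le_mul_left _ (card_image_block_le S hS))
    _ = (k - 1) * r * (2 ^ l * (n / 2 ^ l + 1)) ^ (r - 1) := by rw [mul_pow]; ring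
    _ ≤ k * r * (2 * n) ^ (r - 1) :=
        Nat.mul_le_mul (Nat.mul_le_mul_right _ (Nat.sub_le _ _)) (Nat.pow_le_pow_left h2 _)

theorem exOrderedCrossingPath_le_log {n r k : ℕ} (hr : 2 ≤ r) (hk : 1 ≤ k) :
    exOrderedCrossingPath n r k ≤ (Nat.log 2 n + 1) * (k * r * (2 * n) ^ (r - 1)) := by
  classical
  refine exOrderedCrossingPath_le fun H hH hP => (card_le_card_edgeTuples hH).trans ?_
  have hsub : edgeTuples r H ⊆ (Finset.range (Nat.log 2 n + 1)).biUnion fun l =>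
      (edgeTuples r H).filter (HasScale l) := by
    intro f hf
    obtain ⟨l, hl, hfl⟩ := exists_hasScale hr (mem_edgeTuples.1 hf).1
    refine Finset.mem_biUnion.2 ⟨l, Finset.mem_range.2 ?_, Finset.mem_filter.2 ⟨hf, hfl⟩⟩
    exact Nat.lt_succ_of_le (Nat.le_log_of_pow_le (by norm_num) hl)
  refine (Finset.card_le_card hsub).trans ((Finset.card_biUnion_le_card_mul _ _
    (k * r * (2 * n) ^ (r - 1)) fun l hl => ?_).trans_eq (by simp))
  have hl' : l ≤ Nat.log 2 n := Nat.lt_succ_iff.1 (Finset.mem_range.1 hl)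
  rcases Nat.eq_zero_or_pos n with rfl | hn
  · have : edgeTuples r H = ∅ := Finset.eq_empty_of_forall_notMem fun f _ => (f ⟨0, by omega⟩).elim0
    simp [this]
  · exact card_hasScale_le hr hk hP (Nat.pow_le_of_le_log hn.ne' hl') (Finset.filter_subset _ _)
      fun f hf => (Finset.mem_filter.1 hf).2

/-! ### Long paths: power-of-two construction -/

theorem StrictMono.eq_of_image_univ_eq {n r : ℕ} {f g : Fin r → Fin n} (hf : StrictMono f)
    (hg : StrictMono g) (h : Finset.univ.image f = Finset.univ.image g) : f = g := by
  refine (hf.range_inj hg).1 ?_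
  ext x
  simpa using Finset.ext_iff.1 h x

open Classical in
/-- The `r`-sets whose two least elements differ by a power of two. -/
noncomputable def twoPowGapGraph (n r : ℕ) (hr : 2 ≤ r) : Finset (Finset (Fin n)) :=
  Finset.univ.filter fun e => ∃ f : Fin r → Fin n, StrictMono f ∧ Finset.univ.image f = e ∧
    ∃ i, (f ⟨1, hr⟩ : ℕ) = f ⟨0, Nat.zero_lt_of_lt hr⟩ + 2 ^ i

theorem mem_twoPowGapGraph {n r : ℕ} {hr : 2 ≤ r} {e : Finset (Fin n)} :
    e ∈ twoPowGapGraph n r hr ↔ ∃ f : Fin r → Fin n, StrictMono f ∧ Finset.univ.image f = e ∧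
      ∃ i, (f ⟨1, hr⟩ : ℕ) = f ⟨0, Nat.zero_lt_of_lt hr⟩ + 2 ^ i := by
  simp [twoPowGapGraph]

theorem exists_two_pow_gap {n r : ℕ} {hr : 2 ≤ r} {g : Fin r → Fin n} (hg : StrictMono g)
    (h : Finset.univ.image g ∈ twoPowGapGraph n r hr) :
    ∃ i, (g ⟨1, hr⟩ : ℕ) = g ⟨0, Nat.zero_lt_of_lt hr⟩ + 2 ^ i := by
  obtain ⟨f, hf, hfg, hi⟩ := mem_twoPowGapGraph.1 h
  rwa [hf.eq_of_image_univ_eq hg hfg] at hi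

/-- In a crossing path `v r < v (2 * r) < v 1 < v (r + 1)`. The edges starting at `1`, `r` and `r +
1` make `v 1 - v r`, `v (r + 1) - v r` and `v (r + 1) - v (2 * r)` powers of two. The first and
third are proper parts of the second, hence at most half of it, yet their intervals overlap and
cover it. -/
theorem not_containsCrossingPath_twoPowGapGraph {n r k : ℕ} (hr : 2 ≤ r) (hk : r + 2 ≤ k) :
    ¬ ContainsCrossingPath r k (twoPowGapGraph n r hr) := by
  rintro ⟨v, ⟨-, hedge⟩, hord⟩
  have hsm : ∀ m : Fin r → ℕ, (∀ q : Fin r, q + m q * r < r + k - 1) →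
      StrictMono fun q : Fin r => v (q + m q * r) := fun m hm q q' hqq =>
    hord.lt_of_residue_lt hqq q'.2 (hm q) (hm q')
  -- `m q` selects the member of residue class `q` in the window of edge `t`; classes `0` and `1`
  -- supply the two least vertices.
  have key : ∀ t < k, ∀ m : Fin r → ℕ, (∀ q : Fin r, t ≤ q + m q * r ∧ q + m q * r < t + r) →
      ∃ i, (v (1 + m ⟨1, hr⟩ * r) : ℕ) = v (0 + m ⟨0, Nat.zero_lt_of_lt hr⟩ * r) + 2 ^ i := by
    intro t ht m hm
    refine exists_two_pow_gap (hr := hr)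
      (hsm m fun q => by have := hm q; omega) ?_
    convert hedge t ht using 1
    ext x
    simp only [Finset.mem_image, Finset.mem_univ, true_and, Finset.mem_Ico]
    constructor
    · rintro ⟨q, rfl⟩
      exact ⟨_, hm q, rfl⟩
    · rintro ⟨i, hi, rfl⟩
      refine ⟨⟨i % r, Nat.mod_lt _ (by omega)⟩, congrArg v ?_⟩
      have h1 := hm ⟨i % r, Nat.mod_lt _ (by omega)⟩
      simp only at h1 ⊢
      have hmod : i % r + m ⟨i % r, Nat.mod_lt _ (by omega)⟩ * r ≡ i [MOD r] := by
        simp [Nat.ModEq]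
      exact Nat.ModEq.eq_of_abs_lt hmod (by rw [abs_lt]; omega)
  obtain ⟨b, hb⟩ := key 1 (by omega) (fun q => if (q : ℕ) = 0 then 1 else 0) fun q => by
    by_cases hq : (q : ℕ) = 0
    · simp only [hq, if_true]; omega
    · simp only [hq, if_false]; omega
  obtain ⟨c, hc⟩ := key r (by omega) (fun _ => 1) fun q => by omega
  obtain ⟨d, hd⟩ := key (r + 1) (by omega) (fun q => if (q : ℕ) = 0 then 2 else 1) fun q => by
    by_cases hq : (q : ℕ) = 0
    · simp only [hq, if_true]; omega
    · simp only [hq, if_false]; omega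
  have h1 := hord.chain 0 (by omega) 1 (by omega)
  have h2 := hord.chain_lt 0 (by omega) 2 (by omega)
  have h3 := hord.chain_strict (j := 1) (m := 0) (m' := 1) hr (by omega) (by omega)
  simp only [if_true, one_ne_zero, if_false, Fin.lt_def, zero_mul, add_zero, zero_add,
    one_add_one_eq_two] at hb hc hd h1 h2 h3
  have hbc : 2 * 2 ^ b ≤ 2 ^ c := by
    rw [← pow_succ']
    exact Nat.pow_le_pow_right (by norm_num) ((Nat.pow_lt_pow_iff_right (by norm_num)).1
      (show 2 ^ b < 2 ^ c by omega))
  have hdc : 2 * 2 ^ d ≤ 2 ^ c := by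
    rw [← pow_succ']
    exact Nat.pow_le_pow_right (by norm_num) ((Nat.pow_lt_pow_iff_right (by norm_num)).1
      (show 2 ^ d < 2 ^ c by omega))
  omega

theorem isOrderedRGraph_twoPowGapGraph {n r : ℕ} (hr : 2 ≤ r) :
    IsOrderedRGraph r (twoPowGapGraph n r hr) := by
  intro e he
  obtain ⟨f, hf, rfl, -⟩ := mem_twoPowGapGraph.1 he
  rw [Finset.card_image_of_injective _ hf.injective, Finset.card_univ, Fintype.card_fin]

theorem choose_le_card_strictMono_ge {n m s : ℕ} (hm : m < n) {S : Finset (Fin s → Fin n)}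
    (hS : ∀ g : Fin s → Fin n, StrictMono g → (∀ q, m ≤ g q) → g ∈ S) :
    (n - m).choose s ≤ S.card := by
  have hcard : (Finset.powersetCard s (Finset.Ici (⟨m, hm⟩ : Fin n))).card = (n - m).choose s := by
    rw [Finset.card_powersetCard, Fin.card_Ici]
  rw [← hcard]
  refine (Finset.card_le_card fun e he => ?_).trans
    (Finset.card_image_le (f := fun f => Finset.univ.image f))
  rw [Finset.mem_powersetCard] at he
  obtain ⟨g, hg, rfl⟩ := exists_strictMono_image_eq he.2
  refine Finset.mem_image.2 ⟨g, hS g hg fun q => ?_, rfl⟩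
  exact Fin.le_def.1 (Finset.mem_Ici.1 (he.1 (Finset.mem_image_of_mem g (Finset.mem_univ q))))

/-- Choose the upper `r - 1` elements from `m` on, then put the least element at distance `2 ^ i ≤
m` below them, which never truncates at zero. -/
theorem card_twoPowGapGraph_ge {n m r : ℕ} (hr : 2 ≤ r) (hm0 : 1 ≤ m) (hm : m < n) :
    (Nat.log 2 m + 1) * (n - m).choose (r - 1) ≤ (twoPowGapGraph n r hr).card := by
  classical
  obtain ⟨s, rfl⟩ := Nat.exists_eq_add_of_le' hr
  let S : Finset (Fin (s + 1) → Fin n) :=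
    Finset.univ.filter fun g => StrictMono g ∧ ∀ q, m ≤ g q
  have hS := choose_le_card_strictMono_ge (s := s + 1) hm (S := S) fun g hg h =>
    Finset.mem_filter.2 ⟨Finset.mem_univ _, hg, h⟩
  let ext (x : ℕ × (Fin (s + 1) → Fin n)) : Fin (s + 2) → Fin n :=
    Fin.cons ⟨(x.2 0 : ℕ) - 2 ^ x.1, (Nat.sub_le _ _).trans_lt (x.2 0).2⟩ x.2
  have hpow : ∀ x ∈ Finset.range (Nat.log 2 m + 1) ×ˢ S, StrictMono x.2 ∧ 2 ^ x.1 ≤ (x.2 0 : ℕ) := by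
    intro x hx
    obtain ⟨h1, h2⟩ := Finset.mem_product.1 hx
    obtain ⟨-, h3, h4⟩ := Finset.mem_filter.1 h2
    exact ⟨h3, (Nat.pow_le_of_le_log (by omega)
      (Nat.lt_succ_iff.1 (Finset.mem_range.1 h1))).trans (h4 0)⟩
  have hext : ∀ x ∈ Finset.range (Nat.log 2 m + 1) ×ˢ S, StrictMono (ext x) := by
    intro x hx
    obtain ⟨h1, h2⟩ := hpow x hx
    rw [Fin.strictMono_iff_lt_succ]
    intro i
    refine Fin.cases ?_ (fun i => ?_) i
    · have := Nat.two_pow_pos x.1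
      simp only [ext, Fin.castSucc_zero, Fin.cons_zero, Fin.cons_succ, Fin.lt_def]
      omega
    · simp only [ext, Fin.castSucc_succ, Fin.cons_succ]
      exact h1 (by simp [Fin.lt_def])
  calc (Nat.log 2 m + 1) * (n - m).choose (s + 1)
      ≤ (Finset.range (Nat.log 2 m + 1) ×ˢ S).card := by
        rw [Finset.card_product, Finset.card_range]
        exact Nat.mul_le_mul_left _ hS
    _ ≤ _ := by
        refine Finset.card_le_card_of_injOn (fun x => Finset.univ.image (ext x)) ?_ ?_
        · intro x hx
          refine Finset.mem_coe.2 (mem_twoPowGapGraph.2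
            ⟨ext x, hext x hx, rfl, x.1, ?_⟩)
          change (x.2 0 : ℕ) = (x.2 0 : ℕ) - 2 ^ x.1 + 2 ^ x.1
          have := (hpow x hx).2
          omega
        · intro x hx y hy hxy
          have h := (hext x hx).eq_of_image_univ_eq (hext y hy) hxy
          obtain ⟨h1, h2⟩ := Fin.cons_inj.1 h
          have hx2 := (hpow x hx).2
          have hy2 := (hpow y hy).2
          rw [Fin.mk.injEq, h2] at h1
          rw [h2] at hx2
          exact Prod.ext (Nat.pow_right_injective le_rfl
            (show 2 ^ x.1 = 2 ^ y.1 by omega)) h2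

/-! ### Numerical estimates and conclusion -/

theorem pow_le_mul_choose_half {n r : ℕ} (hr : 2 ≤ r) (hn : 2 * r + 2 ≤ n) :
    n ^ (r - 1) ≤ (2 * r) ^ (r - 1) * ((r - 1).factorial * (n - n / 2).choose (r - 1)) := by
  have h1 : (n - n / 2 + 1 - (r - 1)) ^ (r - 1) ≤
      (r - 1).factorial * (n - n / 2).choose (r - 1) := by
    have := Nat.pow_sub_le_descFactorial (n - n / 2) (r - 1)
    rwa [Nat.descFactorial_eq_factorial_mul_choose] at this
  refine le_trans ?_ (Nat.mul_le_mul_left _ h1)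
  rw [← mul_pow]
  refine Nat.pow_le_pow_left ?_ _
  obtain ⟨x, hx⟩ : ∃ x, n - n / 2 + 1 - (r - 1) = x + 3 :=
    ⟨n - n / 2 + 1 - (r - 1) - 3, by omega⟩
  rw [hx]
  have : n ≤ 2 * (x + 3 + r - 2) := by omega
  have h2 : x + 3 + r - 2 ≤ r * (x + 3) := by
    have : r * (x + 3) = r * x + 3 * r := by ring
    have : 1 * x ≤ r * x := Nat.mul_le_mul_right _ (by omega)
    omega
  rw [mul_assoc]
  omega

theorem log_le_two_mul_natLog_half {n : ℕ} (hn : 2 ≤ n) :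
    Real.log n ≤ 2 * ((Nat.log 2 (n / 2) + 1 : ℕ) : ℝ) := by
  set L := Nat.log 2 (n / 2)
  have h1 : n / 2 < 2 ^ (L + 1) := Nat.lt_pow_succ_log_self (by norm_num) _
  have h2 : n ≤ 2 ^ (L + 2) := by
    rw [pow_succ]
    omega
  have h3 : Real.log n ≤ Real.log ((2 : ℝ) ^ (L + 2)) :=
    Real.log_le_log (by positivity) (by exact_mod_cast h2)
  rw [Real.log_pow] at h3
  have h4 : Real.log 2 ≤ 1 := by linarith [Real.log_two_lt_d9]
  have h5 : ((L + 2 : ℕ) : ℝ) * Real.log 2 ≤ ((L + 2 : ℕ) : ℝ) * 1 := by gcongr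
  push_cast at *
  have : (0 : ℝ) ≤ L := Nat.cast_nonneg _
  linarith

theorem natLog_succ_le_four_mul_log {n : ℕ} (hn : 3 ≤ n) :
    ((Nat.log 2 n + 1 : ℕ) : ℝ) ≤ 4 * Real.log n := by
  have hpos : (0 : ℝ) < n := by positivity
  have h1 : ((2 : ℝ) ^ Nat.log 2 n) ≤ n := by
    exact_mod_cast Nat.pow_log_le_self 2 (by omega : n ≠ 0)
  have h2 := Real.log_le_log (by positivity) h1
  rw [Real.log_pow] at h2
  have h3 : 1 ≤ Real.log n := by
    rw [Real.le_log_iff_exp_le hpos]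
    have : (3 : ℝ) ≤ n := by exact_mod_cast hn
    linarith [Real.exp_one_lt_d9]
  have h4 := Real.log_two_gt_d9
  have h5 : (Nat.log 2 n : ℝ) * (1 / 2) ≤ (Nat.log 2 n : ℝ) * Real.log 2 := by
    gcongr
    linarith
  push_cast
  linarith

theorem theorem2p1 (k r : ℕ) (hk : 1 ≤ k) (hr : 2 ≤ r) :
    (k ≤ r + 1 → ∀ n : ℕ, r + k ≤ n →
      exOrderedCrossingPath n r k = n.choose r - (n - k + 1).choose r) ∧
    (r + 2 ≤ k → ∃ c C : ℝ, 0 < c ∧ 0 < C ∧ ∀ n : ℕ, r + k ≤ n →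
      c * ((n : ℝ) ^ (r - 1) * Real.log n) ≤ (exOrderedCrossingPath n r k : ℝ) ∧
      (exOrderedCrossingPath n r k : ℝ) ≤ C * ((n : ℝ) ^ (r - 1) * Real.log n)) := by
  refine ⟨fun hkr n hn => le_antisymm (exOrderedCrossingPath_le fun H hH hP =>
    card_le_of_not_containsCrossingPath hk hr hkr hn hH hP)
    (le_exOrderedCrossingPath_of_le_succ hk hr hkr hn), fun hkr => ?_⟩
  set D : ℝ := (2 * r : ℝ) ^ (r - 1) * (r - 1).factorial with hD
  have hr0 : (0 : ℝ) < r := by positivity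
  have hk0 : (0 : ℝ) < k := by positivity
  have hD0 : 0 < D := by positivity
  -- The construction is used with `m = n / 2`: `D` compares `n ^ (r - 1)` with the binomial
  -- coefficient, and the factors `2` and `4` convert between `Nat.log 2` and `Real.log`.
  refine ⟨1 / (2 * D), 4 * (k * r * 2 ^ (r - 1)), by positivity, by positivity,
    fun n hn => ⟨?_, ?_⟩⟩
  · have h1 : (n : ℝ) ^ (r - 1) ≤ D * (n - n / 2).choose (r - 1) := by
      have := pow_le_mul_choose_half (n := n) hr (by omega)
      rw [← mul_assoc] at this
      rw [hD]
      exact_mod_cast this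
    have h2 := log_le_two_mul_natLog_half (n := n) (by omega)
    have h3 : ((Nat.log 2 (n / 2) + 1 : ℕ) : ℝ) * ((n - n / 2).choose (r - 1) : ℕ) ≤
        exOrderedCrossingPath n r k := by
      exact_mod_cast (card_twoPowGapGraph_ge (n := n) (m := n / 2) hr (by omega) (by omega)).trans
        (le_exOrderedCrossingPath (isOrderedRGraph_twoPowGapGraph hr)
          (not_containsCrossingPath_twoPowGapGraph hr hkr))
    refine le_trans ?_ h3
    rw [div_mul_eq_mul_div, one_mul, div_le_iff₀ (by positivity)]
    calc (n : ℝ) ^ (r - 1) * Real.log n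
        ≤ (D * (n - n / 2).choose (r - 1)) * (2 * ((Nat.log 2 (n / 2) + 1 : ℕ) : ℝ)) := by
          gcongr
      _ = _ := by ring
  · have h1 : (exOrderedCrossingPath n r k : ℝ) ≤
        ((Nat.log 2 n + 1 : ℕ) : ℝ) * (k * r * (2 * n) ^ (r - 1)) := by
      exact_mod_cast exOrderedCrossingPath_le_log (n := n) hr hk
    refine h1.trans ?_
    calc ((Nat.log 2 n + 1 : ℕ) : ℝ) * (k * r * (2 * n) ^ (r - 1))
        ≤ (4 * Real.log n) * (k * r * (2 * n) ^ (r - 1)) := by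
          gcongr
          exact natLog_succ_le_four_mul_log (by omega)
      _ = _ := by rw [mul_pow]; ring
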